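/- Conventions. Let $P$ be a finite graded poset with minimum $\hat 0$, maximum $\hat 1$, rank function $\mathrm{rank}$ (the length of any maximal chain from $\hat 0$ to the element) and Möbius function $\mu$. For $F<G$ in $P$ let $$\overline{\chi}_{[F,G]}(x)=\frac{1}{x-1}\sum_{F\le H\le G}\mu(F,H)\,x^{\mathrm{rank}(G)-\mathrm{rank}(H)}$$ be the reduced characteristic polynomial of the interval $[F,G]$. For a chain $\mathcal C=\{\mathcal C_1<\dots<\mathcal C_{k+1}\}$ in $P$ put $\overline{\chi}_{P,\mathcal C}(x)=\prod_{i=1}^{k}\overline{\chi}_{[\mathcal C_i,\mathcal C_{i+1}]}(x)$. The *Chow polynomial* and the *augmented Chow polynomial* of $P$ are defined to be $1$ if $P$ has rank $0$, and otherwise are $$\underline{\mathsf H}_P(x)=\sum_{\mathcal C:\ \mathcal C_1=\hat 0,\ \mathcal C_{k+1}=\hat 1}\overline{\chi}_{P,\mathcal C}(x),\qquad \mathsf H_P(x)=\sum_{\mathcal C:\ \mathcal C_{k+1}=\hat 1}x^{\mathrm{rank}(\mathcal C_1)}\,\overline{\chi}_{P,\mathcal C}(x)$$ in $\mathbb Z[x]$,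 where in both cases the sum is over chains with the indicated end points. For $n\ge 0$ let $\mathcal B_n$ be the braid arrangement, consisting of the hyperplanes $\{x_i=x_j\}$, $1\le i<j\le n+1$, in the real vector space $\{x\in\mathbb R^{n+1}\mid x_1+\dots+x_{n+1}=0\}$. Its lattice of flats is the set of all intersections of subfamilies of $\mathcal B_n$ (the empty intersection being the whole space), ordered by reverse inclusion; $\underline{\mathsf H}_{\mathcal B_n}$ and $\mathsf H_{\mathcal B_n}$ denote the Chow and the augmented Chow polynomial of this poset. For a sequence $a=(a_1,\dots,a_n)$ of integers let $\mathsf{Des}(a)=\{\,i\mid 1\le i<n,\ a_i>a_{i+1}\}$ and $\mathsf{des}(a)=|\mathsf{Des}(a)|$. The set $\mathsf{Des}(a)$ is *isolated* if $i\in\mathsf{Des}(a)$ implies $i+1\notin\mathsf{Des}(a)$. **Theorem.** For every $n\ge 1$, $$\underline{\mathsf H}_{\mathcal B_n}(x)=\sum_{a}a_1\cdots a_n\; x^{\mathsf{des}(a)}\,(x+1)^{\,n-1-2\,\mathsf{des}(a)},$$ where the sum ranges over all $a=(a_1,\dots,a_n)$ with $a_i\in\{1,\dots,n+1-i\}$ for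 all $i$ such that $\mathsf{Des}(a)$ is isolated and $1\notin\mathsf{Des}(a)$. Moreover, for every $n\ge 0$, $$\mathsf H_{\mathcal B_n}(x)=\sum_{a}a_1\cdots a_n\; x^{\mathsf{des}(a)}\,(x+1)^{\,n-2\,\mathsf{des}(a)},$$ where the sum ranges over all $a=(a_1,\dots,a_n)$ with $a_i\in\{1,\dots,n+1-i\}$ for all $i$ such that $\mathsf{Des}(a)$ is isolated. -/

import Mathlib

open Polynomial

noncomputable section

namespace ChowPoly

/-! ### Chow polynomials of finite graded posets -/

/-- The rank of an element of a finite poset: the maximal length of a chain ending in it.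
In a graded poset all maximal chains from the minimum to `a` have this same length. -/
def rank {P : Type*} [Preorder P] (a : P) : ℕ := (Order.height a).toNat

open scoped Classical in
/-- The characteristic polynomial of the interval `[a, b]` of a finite graded poset. The Möbius
function of the interval is the restriction of that of the poset, and the rank of `[a, b]` minus
the rank of `c` in `[a, b]` is `rank b - rank c`. -/
def charPoly {P : Type*} [PartialOrder P] [LocallyFiniteOrder P] (a b : P) : ℤ[X] :=
  ∑ c ∈ Finset.Icc a b, C (IncidenceAlgebra.mu ℤ a c) * X ^ (rank b - rank c)

/-- The reduced characteristic polynomial of the interval `[a, b]`, for `a < b`: the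
characteristic polynomial divided by `x - 1` (the division is exact). -/
def redCharPoly {P : Type*} [PartialOrder P] [LocallyFiniteOrder P] (a b : P) : ℤ[X] :=
  charPoly a b /ₘ (X - C 1)

/-- The reduced chain characteristic polynomial of a chain `c 0 < c 1 < ⋯ < c k`: the product of
the reduced characteristic polynomials of the intervals `[c i, c (i + 1)]`. -/
def chainRedCharPoly {P : Type*} [PartialOrder P] [LocallyFiniteOrder P] (c : LTSeries P) : ℤ[X] :=
  ∏ i : Fin c.length, redCharPoly (c i.castSucc) (c i.succ)

open scoped Classical in
/-- The Chow polynomial of a finite graded poset: the sum over all chains from the minimum to the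
maximum. -/
def chowPolynomial (P : Type*) [PartialOrder P] [BoundedOrder P] [Fintype P]
    [LocallyFiniteOrder P] : ℤ[X] :=
  if rank (⊤ : P) = 0 then 1
  else ∑ c : LTSeries P with c.head = ⊥ ∧ c.last = ⊤, chainRedCharPoly c

open scoped Classical in
/-- The augmented Chow polynomial of a finite graded poset: the sum over all (non-empty) chains
ending in the maximum. -/
def augChowPolynomial (P : Type*) [PartialOrder P] [BoundedOrder P] [Fintype P]
    [LocallyFiniteOrder P] : ℤ[X] :=
  if rank (⊤ : P) = 0 then 1
  else ∑ c : LTSeries P with c.last = ⊤, X ^ rank c.head * chainRedCharPoly c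

/-! ### Lattices of flats of hyperplane arrangements -/

/-- A flat of an arrangement `A` of linear subspaces: an intersection of members of `A` (the whole
space is the intersection of the empty subfamily). -/
@[ext]
structure Flat {K V : Type*} [Field K] [AddCommGroup V] [Module K V]
    (A : Set (Submodule K V)) where
  space : Submodule K V
  exists_sInf_eq : ∃ S ⊆ A, sInf S = space

namespace Flat

/-- Flats are ordered by reverse inclusion. -/
instance {K V : Type*} [Field K] [AddCommGroup V] [Module K V] (A : Set (Submodule K V)) :
    PartialOrder (Flat A) where
  le F G := G.space ≤ F.space
  le_refl F := le_refl F.space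
  le_trans _ _ _ h₁ h₂ := le_trans h₂ h₁
  le_antisymm _ _ h₁ h₂ := Flat.ext (le_antisymm h₂ h₁)

instance {K V : Type*} [Field K] [AddCommGroup V] [Module K V] (A : Set (Submodule K V)) :
    BoundedOrder (Flat A) where
  bot := ⟨⊤, ∅, Set.empty_subset A, sInf_empty⟩
  bot_le _ := le_top (α := Submodule K V)
  top := ⟨sInf A, A, subset_rfl, rfl⟩
  le_top F := by
    obtain ⟨S, hS, h⟩ := F.exists_sInf_eq
    exact (sInf_le_sInf hS).trans_eq h

instance {K V : Type*} [Field K] [AddCommGroup V] [Module K V] (A : Set (Submodule K V))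
    [Finite A] : Finite (Flat A) := by
  refine Finite.of_surjective
    (fun S : Set A => (⟨sInf (Subtype.val '' S), _, Subtype.coe_image_subset A S, rfl⟩ : Flat A)) ?_
  rintro ⟨X, S, hS, rfl⟩
  refine ⟨Subtype.val ⁻¹' S, Flat.ext ?_⟩
  simp [Set.inter_eq_self_of_subset_right hS]

instance {K V : Type*} [Field K] [AddCommGroup V] [Module K V] (A : Set (Submodule K V))
    [Finite A] : Fintype (Flat A) := Fintype.ofFinite _

open scoped Classical in
instance {K V : Type*} [Field K] [AddCommGroup V] [Module K V] (A : Set (Submodule K V))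
    [Finite A] : LocallyFiniteOrder (Flat A) := Fintype.toLocallyFiniteOrder

end Flat

/-! ### The braid arrangement -/

/-- The space of vectors in `ℝ ^ (n + 1)` with coordinate sum zero. -/
def sumZero (n : ℕ) : Submodule ℝ (Fin (n + 1) → ℝ) where
  carrier := {x | ∑ i, x i = 0}
  add_mem' {x y} hx hy := by
    simp only [Set.mem_ofPred_eq] at hx hy ⊢
    simp [Finset.sum_add_distrib, hx, hy]
  zero_mem' := by simp
  smul_mem' c x hx := by
    simp only [Set.mem_ofPred_eq] at hx ⊢
    simp [← Finset.mul_sum, hx]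

/-- The hyperplane `x i = x j` in the space of vectors with coordinate sum zero. -/
def hyperplane {n : ℕ} (i j : Fin (n + 1)) : Submodule ℝ (sumZero n) where
  carrier := {x | x.1 i = x.1 j}
  add_mem' {x y} hx hy := by
    simp only [Set.mem_ofPred_eq] at hx hy ⊢
    simp [hx, hy]
  zero_mem' := by simp
  smul_mem' c x hx := by
    simp only [Set.mem_ofPred_eq] at hx ⊢
    simp [hx]

/-- The braid arrangement of rank `n`. -/
def braidArrangement (n : ℕ) : Set (Submodule ℝ (sumZero n)) :=
  {H | ∃ i j : Fin (n + 1), i < j ∧ H = hyperplane i j}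

instance (n : ℕ) : Finite (braidArrangement n) := by
  refine Set.Finite.subset
    (Set.finite_range fun p : Fin (n + 1) × Fin (n + 1) => hyperplane p.1 p.2) ?_
  rintro H ⟨i, j, -, rfl⟩
  exact ⟨(i, j), rfl⟩

/-! ### Sequences and their descents -/

/-- The sequences `(a₁, …, aₙ)` with `aᵢ ∈ {1, …, n + 1 - i}` for `1 ≤ i ≤ n`. The entry `aᵢ` is
stored at the index `i - 1` of `Fin n`. -/
def sequences (n : ℕ) : Finset (Fin n → ℕ) :=
  Fintype.piFinset fun k : Fin n => Finset.Icc 1 (n - k)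

/-- The set of descents `i` with `1 ≤ i < n` and `aᵢ > aᵢ₊₁` (positions counted from one). -/
def Des {n : ℕ} (a : Fin n → ℕ) : Finset ℕ :=
  (Finset.Ico 1 n).filter fun i =>
    ∃ (h₁ : i - 1 < n) (h₂ : i < n), a ⟨i - 1, h₁⟩ > a ⟨i, h₂⟩

/-- A set of positions is isolated if it contains no two consecutive positions. -/
def IsIsolated (D : Finset ℕ) : Prop := ∀ i ∈ D, i + 1 ∉ D

instance (D : Finset ℕ) : Decidable (IsIsolated D) :=
  inferInstanceAs (Decidable (∀ i ∈ D, i + 1 ∉ D))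

end ChowPoly

end

noncomputable section

namespace ChowPoly

/-! ### Chow polynomials of intervals and their recursion -/

section Poset

/-- Prepend an element to a strictly increasing series. -/
def consSeries {P : Type*} [Preorder P] (a : P) (c : LTSeries P) (h : a < c.head) :
    LTSeries P where
  length := c.length + 1
  toFun := Fin.cons a c.toFun
  step i := by
    refine Fin.cases ?_ (fun j => ?_) i
    · exact h
    · exact c.step j

lemma consSeries_injective {P : Type*} [Preorder P] {a : P} {c d : LTSeries P} {h : a < c.head}
    {h' : a < d.head} (e : consSeries a c h = consSeries a d h') : c = d := by
  obtain ⟨k, f, hf⟩ := c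
  obtain ⟨l, g, hg⟩ := d
  simp only [consSeries, RelSeries.mk.injEq, add_left_inj] at e
  obtain ⟨rfl, e⟩ := e
  obtain rfl : f = g := Fin.cons_right_injective (α := fun _ => P) a (eq_of_heq e)
  rfl

lemma exists_consSeries {P : Type*} [Preorder P] (c : LTSeries P) (hc : c.length ≠ 0) :
    ∃ (d : LTSeries P) (h : c.head < d.head), consSeries c.head d h = c := by
  obtain ⟨k, f, hf⟩ := c
  obtain _ | k := k
  · exact absurd rfl hc
  · refine ⟨⟨k, Fin.tail f, fun i => hf i.succ⟩, hf 0, ?_⟩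
    simp only [consSeries, RelSeries.mk.injEq, heq_eq_eq, true_and]
    exact Fin.cons_self_tail f

lemma length_eq_zero_of_head_eq_top {P : Type*} [PartialOrder P] [BoundedOrder P]
    (c : LTSeries P) (h : c.head = ⊤) : c.length = 0 := by
  by_contra hc
  obtain ⟨d, hd, -⟩ := exists_consSeries c hc
  exact not_top_lt (h ▸ hd)

variable {P : Type*} [PartialOrder P] [LocallyFiniteOrder P]

lemma chainRedCharPoly_consSeries (a : P) (c : LTSeries P) (h : a < c.head) :
    chainRedCharPoly (consSeries a c h) = redCharPoly a c.head * chainRedCharPoly c := by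
  unfold chainRedCharPoly
  exact Fin.prod_univ_succ (n := c.length) _

lemma X_sub_one_mul_redCharPoly {a b : P} (h : a < b) :
    (X - C 1) * redCharPoly a b = charPoly a b := by
  classical
  refine mul_divByMonic_eq_iff_isRoot.2 ?_
  have := IncidenceAlgebra.sum_Icc_mu_right (𝕜 := ℤ) a b
  rw [if_neg h.ne] at this
  simp only [charPoly, IsRoot.def, eval_finsetSum, eval_mul, eval_C, eval_pow, eval_X, one_pow,
    mul_one]
  convert! this

lemma charPoly_self (a : P) : charPoly a a = 1 := by
  simp [charPoly]

open scoped Classical in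
/-- Möbius inversion of the definition of the characteristic polynomial. -/
lemma sum_charPoly (a b : P) (h : a ≤ b) :
    ∑ c ∈ Finset.Icc a b, charPoly c b = X ^ (rank b - rank a) := by
  unfold charPoly
  have : ∀ c ∈ Finset.Icc a b, ∑ d ∈ Finset.Icc c b,
      C (IncidenceAlgebra.mu ℤ c d) * X ^ (rank b - rank d) =
      ∑ d ∈ Finset.Icc a b, if c ≤ d then
      C (IncidenceAlgebra.mu ℤ c d) * X ^ (rank b - rank d) else 0 := by
    intro c hc
    rw [← Finset.sum_filter]
    refine Finset.sum_congr ?_ fun _ _ => rfl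
    ext d
    simp only [Finset.mem_Icc, Finset.mem_filter] at hc ⊢
    exact ⟨fun h => ⟨⟨hc.1.trans h.1, h.2⟩, h.1⟩, fun h => ⟨h.2, h.1.2⟩⟩
  rw [Finset.sum_congr rfl this, Finset.sum_comm]
  have : ∀ d ∈ Finset.Icc a b, (∑ c ∈ Finset.Icc a b, if c ≤ d then
      C (IncidenceAlgebra.mu ℤ c d) * X ^ (rank b - rank d) else 0) =
      if a = d then X ^ (rank b - rank d) else (0 : ℤ[X]) := by
    intro d hd
    rw [← Finset.sum_filter]
    have e : (Finset.Icc a b).filter (· ≤ d) = Finset.Icc a d := by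
      ext c
      simp only [Finset.mem_Icc, Finset.mem_filter] at hd ⊢
      exact ⟨fun h => ⟨h.1.1, h.2⟩, fun h => ⟨⟨h.1, h.2.trans hd.2⟩, h.2⟩⟩
    rw [e, ← Finset.sum_mul, ← map_sum]
    have := IncidenceAlgebra.sum_Icc_mu_left (𝕜 := ℤ) a d
    rw [this]
    split_ifs <;> simp
  rw [Finset.sum_congr rfl this, Finset.sum_ite_eq, if_pos (Finset.left_mem_Icc.2 h)]

variable [BoundedOrder P] [Fintype P]

open scoped Classical in
/-- The Chow polynomial of the interval from an element to the maximum. -/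
def upperChow (a : P) : ℤ[X] :=
  ∑ c : LTSeries P with c.head = a ∧ c.last = ⊤, chainRedCharPoly c

lemma upperChow_top : upperChow (⊤ : P) = 1 := by
  classical
  unfold upperChow
  rw [Finset.sum_eq_single (RelSeries.singleton _ ⊤)]
  · exact Fin.prod_univ_zero _
  · intro c hc hne
    refine absurd ?_ hne
    simp only [Finset.mem_filter, Finset.mem_univ, true_and] at hc
    have h0 := length_eq_zero_of_head_eq_top c hc.1
    obtain ⟨k, f, hf⟩ := c
    obtain rfl : k = 0 := h0
    refine RelSeries.ext rfl (funext fun i => ?_)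
    obtain rfl : i = 0 := Subsingleton.elim (α := Fin 1) _ _
    exact hc.1
  · intro h
    refine absurd ?_ h
    simp

open scoped Classical in
lemma upperChow_eq_sum (a : P) (ha : a ≠ ⊤) :
    upperChow a = ∑ b : P with a < b, redCharPoly a b * upperChow b := by
  have h1 : ∑ b : P with a < b, redCharPoly a b * upperChow b =
      ∑ c : LTSeries P with a < c.head ∧ c.last = ⊤,
        redCharPoly a c.head * chainRedCharPoly c := by
    rw [← Finset.sum_fiberwise_of_maps_to (t := Finset.univ.filter (a < ·)) (g := RelSeries.head)]
    · refine Finset.sum_congr rfl fun b hb => ?_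
      simp only [Finset.mem_filter, Finset.mem_univ, true_and] at hb
      rw [upperChow, Finset.mul_sum]
      refine Finset.sum_congr ?_ ?_
      · ext c
        simp only [Finset.mem_filter, Finset.mem_univ, true_and]
        constructor
        · rintro ⟨rfl, h⟩
          exact ⟨⟨hb, h⟩, rfl⟩
        · rintro ⟨⟨_, h⟩, rfl⟩
          exact ⟨rfl, h⟩
      · intro c hc
        simp only [Finset.mem_filter, Finset.mem_univ, true_and] at hc
        rw [hc.2]
    · intro c hc
      simp only [Finset.mem_filter, Finset.mem_univ, true_and] at hc ⊢
      exact hc.1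
  rw [h1, upperChow]
  symm
  refine Finset.sum_bij (fun c hc => consSeries a c (Finset.mem_filter.1 hc).2.1) ?_ ?_ ?_ ?_
  · intro c hc
    simp only [Finset.mem_filter, Finset.mem_univ, true_and] at hc ⊢
    exact ⟨rfl, hc.2⟩
  · intro c hc d hd e
    exact consSeries_injective e
  · intro c hc
    simp only [Finset.mem_filter, Finset.mem_univ, true_and] at hc
    have h0 : c.length ≠ 0 := by
      intro h0
      apply ha
      rw [← hc.1, ← hc.2, RelSeries.head, RelSeries.last]
      congr 1
      ext
      simp [h0]
    obtain ⟨d, hd, e⟩ := exists_consSeries c h0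
    obtain ⟨rfl, h2⟩ := hc
    refine ⟨d, ?_, e⟩
    simp only [Finset.mem_filter, Finset.mem_univ, true_and]
    refine ⟨hd, ?_⟩
    rw [← h2]
    conv_rhs => rw [← e]
    rfl
  · intro c hc
    rw [chainRedCharPoly_consSeries]

open scoped Classical in
lemma sum_charPoly_mul_upperChow (a : P) :
    ∑ b : P with a ≤ b, charPoly a b * upperChow b = if a = ⊤ then 1 else X * upperChow a := by
  have h : (Finset.univ.filter (a ≤ ·) : Finset P) = insert a (Finset.univ.filter (a < ·)) := by
    ext b
    simp [le_iff_eq_or_lt, eq_comm]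
  rw [h, Finset.sum_insert (by simp), charPoly_self, one_mul]
  split_ifs with ha
  · subst ha
    rw [upperChow_top, Finset.sum_eq_zero, add_zero]
    intro b hb
    simp at hb
  · have : ∑ b : P with a < b, charPoly a b * upperChow b = (X - C 1) * upperChow a := by
      rw [upperChow_eq_sum a ha, Finset.mul_sum]
      refine Finset.sum_congr rfl fun b hb => ?_
      rw [← X_sub_one_mul_redCharPoly (Finset.mem_filter.1 hb).2, mul_assoc]
    rw [this, C_1]
    ring

open scoped Classical in
/-- The recursion for the Chow polynomials of upper intervals, free of Möbius functions. -/
lemma sum_X_pow_mul_upperChow (a : P) :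
    ∑ b : P with a ≤ b, X ^ (rank b - rank a) * upperChow b =
      ∑ b : P with a ≤ b, if b = ⊤ then 1 else X * upperChow b := by
  have h1 : ∀ b ∈ (Finset.univ.filter (a ≤ ·) : Finset P),
      X ^ (rank b - rank a) * upperChow b =
        ∑ c : P with a ≤ c, if c ≤ b then charPoly c b * upperChow b else 0 := by
    intro b hb
    rw [← sum_charPoly a b (Finset.mem_filter.1 hb).2, Finset.sum_mul, ← Finset.sum_filter]
    refine Finset.sum_congr ?_ fun _ _ => rfl
    ext c
    simp
  rw [Finset.sum_congr rfl h1, Finset.sum_comm]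
  refine Finset.sum_congr rfl fun c hc => ?_
  rw [← sum_charPoly_mul_upperChow c, ← Finset.sum_filter]
  refine Finset.sum_congr ?_ fun _ _ => rfl
  ext b
  simp only [Finset.mem_filter, Finset.mem_univ, true_and] at hc ⊢
  exact ⟨fun h => h.2, fun h => ⟨hc.trans h, h⟩⟩

/-- The recursion determines the Chow polynomials of the upper intervals. -/
lemma upperChow_eq_of_recursion (f : P → ℤ[X]) (hf : ∀ a : P, open scoped Classical in
    ∑ b : P with a ≤ b, X ^ (rank b - rank a) * f b =
      ∑ b : P with a ≤ b, if b = ⊤ then 1 else X * f b) (a : P) : upperChow a = f a := by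
  classical
  induction a using WellFoundedGT.induction with
  | ind a ih =>
  have h : (Finset.univ.filter (a ≤ ·) : Finset P) = insert a (Finset.univ.filter (a < ·)) := by
    ext b
    simp [le_iff_eq_or_lt, eq_comm]
  have e1 := sum_X_pow_mul_upperChow a
  have e2 := hf a
  rw [h, Finset.sum_insert (by simp), Finset.sum_insert (by simp), Nat.sub_self, pow_zero,
    one_mul] at e1 e2
  have h1 : ∑ b : P with a < b, X ^ (rank b - rank a) * upperChow b =
      ∑ b : P with a < b, X ^ (rank b - rank a) * f b :=
    Finset.sum_congr rfl fun b hb => by rw [ih b (Finset.mem_filter.1 hb).2]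
  have h2 : (∑ b : P with a < b, if b = ⊤ then 1 else X * upperChow b) =
      ∑ b : P with a < b, if b = ⊤ then 1 else X * f b :=
    Finset.sum_congr rfl fun b hb => by rw [ih b (Finset.mem_filter.1 hb).2]
  rw [h1, h2] at e1
  split_ifs at e1 e2 with ha
  · linear_combination e1 - e2
  · have h3 : (X - C 1 : ℤ[X]) * (upperChow a - f a) = 0 := by
      rw [C_1]
      linear_combination e2 - e1
    have h4 := (mul_eq_zero.1 h3).resolve_left (X_sub_C_ne_zero 1)
    exact sub_eq_zero.1 h4

lemma bot_eq_top_of_rank_top_eq_zero {P : Type*} [PartialOrder P] [BoundedOrder P] [Fintype P]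
    (h : rank (⊤ : P) = 0) : (⊥ : P) = ⊤ := by
  have h0 : Order.height (⊤ : P) ≤ (Fintype.card P : ℕ) :=
    Order.height_le fun p _ => by exact_mod_cast p.length_lt_card.le
  have h1 : Order.height (⊤ : P) = 0 := by
    rw [rank, ENat.toNat_eq_zero] at h
    exact h.resolve_right (h0.trans_lt (ENat.natCast_lt_top _)).ne
  rw [Order.height_eq_zero] at h1
  exact le_antisymm bot_le (h1 bot_le)

lemma chowPolynomial_eq_upperChow : chowPolynomial P = upperChow (⊥ : P) := by
  unfold chowPolynomial
  split_ifs with h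
  · rw [bot_eq_top_of_rank_top_eq_zero h, upperChow_top]
  · rfl

lemma augChowPolynomial_eq_sum : augChowPolynomial P = ∑ a : P, X ^ rank a * upperChow a := by
  classical
  unfold augChowPolynomial
  split_ifs with h
  · have : Subsingleton P := subsingleton_of_bot_eq_top (bot_eq_top_of_rank_top_eq_zero h)
    rw [Fintype.sum_subsingleton _ ⊤, h, upperChow_top, pow_zero, one_mul]
  · rw [← Finset.sum_fiberwise _ RelSeries.head]
    refine Finset.sum_congr rfl fun a _ => ?_
    rw [upperChow, Finset.mul_sum, Finset.filter_filter]
    refine Finset.sum_congr ?_ fun c hc => ?_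
    · ext c
      simp [and_comm]
    · rw [(Finset.mem_filter.1 hc).2.1]

end Poset

/-! ### Sums over sequences with isolated descents -/

section Sequences

/-- The sequence is non-empty and its first entry is less than `t`. -/
def StartsBelow {n : ℕ} (a : Fin n → ℕ) (t : ℕ) : Prop := ∃ h : 0 < n, a ⟨0, h⟩ < t

instance {n : ℕ} (a : Fin n → ℕ) (t : ℕ) : Decidable (StartsBelow a t) :=
  Classical.propDecidable _

lemma Des_cons {n : ℕ} (s : ℕ) (a : Fin n → ℕ) :
    Des (Fin.cons s a : Fin (n + 1) → ℕ) =
      (Des a).image (· + 1) ∪ if StartsBelow a s then {1} else ∅ := by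
  ext i
  have h2 : ∀ (j : ℕ) (h : j + 1 < n + 1),
      (Fin.cons s a : Fin (n + 1) → ℕ) ⟨j + 1, h⟩ = a ⟨j, by omega⟩ := fun j h => rfl
  have h1 : ∀ (h : 0 < n + 1), (Fin.cons s a : Fin (n + 1) → ℕ) ⟨0, h⟩ = s := fun h => rfl
  rcases i with _ | _ | i
  · simp only [Des, Finset.mem_filter, Finset.mem_union, Finset.mem_image]
    split_ifs <;> simp
  · simp only [Des, Finset.mem_filter, Finset.mem_union, Finset.mem_image,
      Finset.mem_Ico]
    simp only [zero_add, Nat.sub_self, h1]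
    constructor
    · rintro ⟨_, h3, h4, h5⟩
      rw [if_pos]
      · simp
      · exact ⟨by omega, h5⟩
    · rintro (⟨k, ⟨h3, -⟩, h4⟩ | h)
      · omega
      · split_ifs at h with h6
        · obtain ⟨h6, h7⟩ := h6
          exact ⟨by omega, by omega, by omega, h7⟩
        · simp at h
  · simp only [Des, Finset.mem_filter, Finset.mem_union, Finset.mem_image, Finset.mem_Ico]
    simp only [Nat.add_sub_cancel, h2]
    constructor
    · rintro ⟨h3, h4, h5, h6⟩
      exact Or.inl ⟨i + 1, ⟨by omega, by omega, by omega, h6⟩, rfl⟩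
    · rintro (⟨k, ⟨h3, h4⟩, h5⟩ | h)
      · obtain rfl : k = i + 1 := by omega
        simp only [Nat.add_sub_cancel] at h4
        obtain ⟨h4, h6, h7⟩ := h4
        exact ⟨by omega, by omega, by omega, h7⟩
      · split_ifs at h <;> simp at h

lemma zero_notMem_Des {n : ℕ} (a : Fin n → ℕ) : 0 ∉ Des a := by simp [Des]

lemma Des_cons_of_not {n : ℕ} {s : ℕ} {a : Fin n → ℕ} (h : ¬ StartsBelow a s) :
    Des (Fin.cons s a : Fin (n + 1) → ℕ) = (Des a).image (· + 1) := by
  rw [Des_cons, if_neg h, Finset.union_empty]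

lemma Des_cons_of {n : ℕ} {s : ℕ} {a : Fin n → ℕ} (h : StartsBelow a s) :
    Des (Fin.cons s a : Fin (n + 1) → ℕ) = insert 1 ((Des a).image (· + 1)) := by
  rw [Des_cons, if_pos h, Finset.union_comm, Finset.singleton_union]

lemma one_notMem_image_Des {n : ℕ} (a : Fin n → ℕ) : 1 ∉ (Des a).image (· + 1) := by
  simp [zero_notMem_Des]

lemma card_image_succ (D : Finset ℕ) : (D.image (· + 1)).card = D.card :=
  Finset.card_image_of_injective _ (add_left_injective 1)

lemma isIsolated_image_succ (D : Finset ℕ) : IsIsolated (D.image (· + 1)) ↔ IsIsolated D := by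
  simp [IsIsolated]

lemma one_mem_Des_cons {n : ℕ} {s : ℕ} {a : Fin n → ℕ} :
    1 ∈ Des (Fin.cons s a : Fin (n + 1) → ℕ) ↔ StartsBelow a s := by
  by_cases h : StartsBelow a s
  · simp [Des_cons_of h, h]
  · rw [Des_cons_of_not h]
    simp [zero_notMem_Des, h]

lemma isIsolated_Des_cons_of {n : ℕ} {s : ℕ} {a : Fin n → ℕ} (h : StartsBelow a s) :
    IsIsolated (Des (Fin.cons s a : Fin (n + 1) → ℕ)) ↔ IsIsolated (Des a) ∧ 1 ∉ Des a := by
  rw [Des_cons_of h]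
  simp [IsIsolated, and_comm]

lemma isIsolated_Des_cons_of_not {n : ℕ} {s : ℕ} {a : Fin n → ℕ} (h : ¬ StartsBelow a s) :
    IsIsolated (Des (Fin.cons s a : Fin (n + 1) → ℕ)) ↔ IsIsolated (Des a) := by
  rw [Des_cons_of_not h, isIsolated_image_succ]

lemma card_Des_cons_of {n : ℕ} {s : ℕ} {a : Fin n → ℕ} (h : StartsBelow a s) :
    (Des (Fin.cons s a : Fin (n + 1) → ℕ)).card = (Des a).card + 1 := by
  rw [Des_cons_of h, Finset.card_insert_of_notMem (one_notMem_image_Des a), card_image_succ]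

lemma card_Des_cons_of_not {n : ℕ} {s : ℕ} {a : Fin n → ℕ} (h : ¬ StartsBelow a s) :
    (Des (Fin.cons s a : Fin (n + 1) → ℕ)).card = (Des a).card := by
  rw [Des_cons_of_not h, card_image_succ]

lemma two_mul_card_Des_le {n : ℕ} {a : Fin n → ℕ} (h : IsIsolated (Des a)) :
    2 * (Des a).card ≤ n := by
  have h1 : Disjoint (Des a) ((Des a).image (· + 1)) := by
    rw [Finset.disjoint_left]
    rintro i hi hi'
    obtain ⟨j, hj, rfl⟩ := Finset.mem_image.1 hi'
    exact h j hj hi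
  have h2 : Des a ∪ (Des a).image (· + 1) ⊆ Finset.Ico 1 (n + 1) := by
    intro i hi
    simp only [Des, Finset.mem_union, Finset.mem_image, Finset.mem_filter, Finset.mem_Ico] at hi ⊢
    obtain hi | ⟨j, hj, rfl⟩ := hi <;> omega
  have h3 := Finset.card_le_card h2
  rw [Finset.card_union_of_disjoint h1, card_image_succ, Nat.card_Ico] at h3
  omega

lemma sum_sequences_succ {M : Type*} [AddCommMonoid M] (n : ℕ) (f : (Fin (n + 1) → ℕ) → M) :
    ∑ a ∈ sequences (n + 1), f a =
      ∑ s ∈ Finset.Icc 1 (n + 1), ∑ a ∈ sequences n, f (Fin.cons s a) := by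
  rw [← Finset.sum_product']
  symm
  refine Finset.sum_nbij' (fun p => Fin.cons p.1 p.2) (fun a => (a 0, Fin.tail a)) ?_ ?_ ?_ ?_ ?_
  · rintro ⟨s, a⟩ h
    simp only [sequences, Finset.mem_product, Fintype.mem_piFinset] at h ⊢
    refine Fin.cases ?_ fun i => ?_
    · simpa using h.1
    · simpa using h.2 i
  · rintro a h
    simp only [sequences, Finset.mem_product, Fintype.mem_piFinset] at h ⊢
    refine ⟨by simpa using h 0, fun i => ?_⟩
    simpa [Fin.tail] using h i.succ
  · rintro ⟨s, a⟩ -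
    simp
  · rintro a -
    simp
  · rintro ⟨s, a⟩ -
    rfl

/-- The sum over the sequences with isolated descents, without a descent in the first position,
and whose first entry is at least `t`. -/
def chowSum (n t : ℕ) : ℤ[X] :=
  ∑ a ∈ sequences n with (IsIsolated (Des a) ∧ 1 ∉ Des a) ∧ ¬ StartsBelow a t,
    (∏ i, (a i : ℤ[X])) * X ^ (Des a).card * (X + 1) ^ (n - 1 - 2 * (Des a).card)

/-- The sum over the sequences with isolated descents whose first entry is at least `t`. -/
def augChowSum (n t : ℕ) : ℤ[X] :=
  ∑ a ∈ sequences n with IsIsolated (Des a) ∧ ¬ StartsBelow a t,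
    (∏ i, (a i : ℤ[X])) * X ^ (Des a).card * (X + 1) ^ (n - 2 * (Des a).card)

lemma not_startsBelow_one {n : ℕ} {a : Fin n → ℕ} (ha : a ∈ sequences n) :
    ¬ StartsBelow a 1 := by
  rintro ⟨h, h'⟩
  have := Finset.mem_Icc.1 (Fintype.mem_piFinset.1 ha ⟨0, h⟩)
  omega

lemma chowSum_one (n : ℕ) : chowSum n 1 =
    ∑ a ∈ sequences n with IsIsolated (Des a) ∧ 1 ∉ Des a,
      (∏ i, (a i : ℤ[X])) * X ^ (Des a).card * (X + 1) ^ (n - 1 - 2 * (Des a).card) := by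
  refine Finset.sum_congr (Finset.filter_congr fun a ha => ?_) fun _ _ => rfl
  exact and_iff_left (not_startsBelow_one ha)

lemma augChowSum_one (n : ℕ) : augChowSum n 1 =
    ∑ a ∈ sequences n with IsIsolated (Des a),
      (∏ i, (a i : ℤ[X])) * X ^ (Des a).card * (X + 1) ^ (n - 2 * (Des a).card) := by
  refine Finset.sum_congr (Finset.filter_congr fun a ha => ?_) fun _ _ => rfl
  exact and_iff_left (not_startsBelow_one ha)

lemma chowSum_zero (t : ℕ) : chowSum 0 t = 1 := by
  have : ∀ a : Fin 0 → ℕ, Des a = ∅ := fun a => by simp [Des]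
  simp [chowSum, this, sequences, IsIsolated, StartsBelow]

lemma augChowSum_zero (t : ℕ) : augChowSum 0 t = 1 := by
  have : ∀ a : Fin 0 → ℕ, Des a = ∅ := fun a => by simp [Des]
  simp [augChowSum, this, sequences, IsIsolated, StartsBelow]

lemma startsBelow_cons {n s t : ℕ} {a : Fin n → ℕ} :
    StartsBelow (Fin.cons s a : Fin (n + 1) → ℕ) t ↔ s < t :=
  ⟨fun ⟨_, h⟩ => h, fun h => ⟨n.succ_pos, h⟩⟩

lemma prod_cons {n s : ℕ} {a : Fin n → ℕ} :
    ∏ i, ((Fin.cons s a : Fin (n + 1) → ℕ) i : ℤ[X]) = s * ∏ i, (a i : ℤ[X]) := by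
  simp [Fin.prod_univ_succ]

lemma sum_Icc_one_ite {M : Type*} [AddCommMonoid M] (n t : ℕ) (ht : 1 ≤ t) (f : ℕ → M) :
    (∑ s ∈ Finset.Icc 1 n, if t ≤ s then f s else 0) = ∑ s ∈ Finset.Icc t n, f s := by
  rw [← Finset.sum_filter]
  refine Finset.sum_congr ?_ fun _ _ => rfl
  ext s
  simp only [Finset.mem_filter, Finset.mem_Icc]
  omega

lemma chowSum_succ (n t : ℕ) (ht : 1 ≤ t) :
    chowSum (n + 1) t = ∑ s ∈ Finset.Icc t (n + 1), (s : ℤ[X]) * augChowSum n s := by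
  rw [chowSum, Finset.sum_filter, sum_sequences_succ, ← sum_Icc_one_ite _ _ ht]
  refine Finset.sum_congr rfl fun s _ => ?_
  split_ifs with hs
  · rw [augChowSum, Finset.mul_sum, Finset.sum_filter]
    refine Finset.sum_congr rfl fun a _ => ?_
    simp only [one_mem_Des_cons, startsBelow_cons, not_lt]
    by_cases h : StartsBelow a s
    · simp [h]
    · simp only [h, hs, isIsolated_Des_cons_of_not h, card_Des_cons_of_not h, not_false_eq_true,
        and_true, prod_cons, Nat.add_sub_cancel, mul_assoc]
  · refine Finset.sum_eq_zero fun a _ => if_neg ?_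
    rw [startsBelow_cons, not_lt]
    exact fun h => hs h.2

lemma sum_startsBelow (n s : ℕ) :
    ∑ a ∈ sequences n with (IsIsolated (Des a) ∧ 1 ∉ Des a) ∧ StartsBelow a s,
      (∏ i, (a i : ℤ[X])) * X ^ (Des a).card * (X + 1) ^ (n - 1 - 2 * (Des a).card) =
    chowSum n 1 - chowSum n s := by
  rw [eq_sub_iff_add_eq, chowSum_one, chowSum,
    ← Finset.filter_filter (fun a => IsIsolated (Des a) ∧ 1 ∉ Des a),
    ← Finset.filter_filter (fun a => IsIsolated (Des a) ∧ 1 ∉ Des a),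
    Finset.sum_filter_add_sum_filter_not]

lemma augChowSum_succ (n t : ℕ) (ht : 1 ≤ t) :
    augChowSum (n + 1) t = (X + 1) * chowSum (n + 1) t +
      X * ∑ s ∈ Finset.Icc t (n + 1), (s : ℤ[X]) * (chowSum n 1 - chowSum n s) := by
  rw [chowSum_succ n t ht, Finset.mul_sum, Finset.mul_sum, ← Finset.sum_add_distrib,
    augChowSum, Finset.sum_filter, sum_sequences_succ, ← sum_Icc_one_ite _ _ ht]
  refine Finset.sum_congr rfl fun s _ => ?_
  split_ifs with hs
  · rw [← sum_startsBelow, augChowSum, Finset.mul_sum, Finset.mul_sum, Finset.mul_sum,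
      Finset.mul_sum, Finset.sum_filter, Finset.sum_filter, ← Finset.sum_add_distrib]
    refine Finset.sum_congr rfl fun a _ => ?_
    simp only [startsBelow_cons, not_lt]
    by_cases h : StartsBelow a s
    · simp only [h, hs, isIsolated_Des_cons_of h, card_Des_cons_of h, not_true_eq_false,
        and_true, and_false, if_false, zero_add, prod_cons]
      split_ifs
      · rw [show n + 1 - 2 * ((Des a).card + 1) = n - 1 - 2 * (Des a).card by omega]
        ring
      · rfl
    · simp only [h, hs, isIsolated_Des_cons_of_not h, card_Des_cons_of_not h, not_false_eq_true,
        and_true, and_false, if_false, add_zero, prod_cons]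
      split_ifs with h'
      · have := two_mul_card_Des_le h'
        rw [show n + 1 - 2 * (Des a).card = (n - 2 * (Des a).card) + 1 by omega]
        ring
      · rfl
  · refine Finset.sum_eq_zero fun a _ => if_neg ?_
    rw [startsBelow_cons, not_lt]
    exact fun h => hs h.2

/-- The complete homogeneous symmetric polynomial of degree `j` in the numbers `t, …, k`. -/
def hsum : ℕ → ℕ → ℕ → ℕ
  | 0, _, _ => 1
  | j + 1, t, k => ∑ s ∈ Finset.Icc t k, s * hsum j s k

lemma hsum_succ_eq_zero {j t k : ℕ} (h : k < t) : hsum (j + 1) t k = 0 := by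
  rw [hsum, Finset.Icc_eq_empty (by omega), Finset.sum_empty]

lemma hsum_succ_succ (j t k : ℕ) (ht : t ≤ k + 1) :
    hsum (j + 1) t (k + 1) = hsum (j + 1) t k + (k + 1) * hsum j t (k + 1) := by
  induction j generalizing t with
  | zero => simp [hsum, Finset.sum_Icc_succ_top ht]
  | succ j ih =>
    rw [hsum, Finset.sum_Icc_succ_top ht, ih _ le_rfl, hsum_succ_eq_zero (Nat.lt_succ_self k),
      zero_add, hsum, hsum, Finset.sum_Icc_succ_top ht, mul_add (k + 1), Finset.mul_sum,
      ← add_assoc, ← Finset.sum_add_distrib]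
    congr 1
    refine Finset.sum_congr rfl fun s hs => ?_
    rw [ih s (by have := Finset.mem_Icc.1 hs; omega)]
    ring

lemma hsum_one_eq_stirlingSecond (j k : ℕ) : hsum j 1 k = Nat.stirlingSecond (k + j) k := by
  induction k generalizing j with
  | zero =>
    cases j with
    | zero => rfl
    | succ j => rw [hsum_succ_eq_zero one_pos, zero_add, Nat.stirlingSecond_succ_zero]
  | succ k ihk =>
    induction j with
    | zero => rw [add_zero, Nat.stirlingSecond_self, hsum]
    | succ j ihj =>
      rw [hsum_succ_succ j 1 k (by omega), ihk, ihj,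
        show k + 1 + (j + 1) = (k + 1 + j) + 1 by ring, Nat.stirlingSecond_succ_succ, add_comm,
        show k + (j + 1) = k + 1 + j by ring]

/-- The sum over the weakly increasing initial segments of sequences of length `n` with entries at
least `t`, where a segment of length `j` has weight `z ^ j * w (n - j)`. -/
def segmentSum (w : ℕ → ℤ[X]) (z : ℤ[X]) (n t : ℕ) : ℤ[X] :=
  ∑ j ∈ Finset.range (n + 1), hsum j t (n + 1 - j) * z ^ j * w (n - j)

lemma segmentSum_zero (w : ℕ → ℤ[X]) (z : ℤ[X]) (t : ℕ) : segmentSum w z 0 t = w 0 := by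
  simp [segmentSum, hsum]

lemma segmentSum_succ (w : ℕ → ℤ[X]) (z : ℤ[X]) (n t : ℕ) :
    segmentSum w z (n + 1) t =
      w (n + 1) + z * ∑ s ∈ Finset.Icc t (n + 1), (s : ℤ[X]) * segmentSum w z n s := by
  rw [segmentSum, Finset.sum_range_succ', add_comm]
  congr 1
  · simp [hsum]
  · simp only [segmentSum, Finset.mul_sum]
    rw [Finset.sum_comm]
    refine Finset.sum_congr rfl fun j hj => ?_
    have h : hsum (j + 1) t (n + 1 + 1 - (j + 1)) =
        ∑ s ∈ Finset.Icc t (n + 1), s * hsum j s (n + 1 - j) := by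
      rw [hsum, Nat.add_sub_add_right]
      refine Finset.sum_subset (Finset.Icc_subset_Icc le_rfl (by omega)) fun s hs hs' => ?_
      cases j with
      | zero => exact absurd hs hs'
      | succ j =>
        rw [hsum_succ_eq_zero, mul_zero]
        simp only [Finset.mem_Icc] at hs hs'
        omega
    rw [h, Nat.add_sub_add_right]
    push_cast
    rw [Finset.sum_mul, Finset.sum_mul]
    refine Finset.sum_congr rfl fun s _ => ?_
    ring

lemma segmentSum_X (n t : ℕ) (ht : 1 ≤ t) :
    segmentSum (fun m => chowSum m 1) X n t = augChowSum n t + chowSum n 1 - chowSum n t := by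
  induction n generalizing t with
  | zero => simp [segmentSum_zero, chowSum_zero, augChowSum_zero]
  | succ n ih =>
    rw [segmentSum_succ, augChowSum_succ n t ht]
    have : ∑ s ∈ Finset.Icc t (n + 1), (s : ℤ[X]) * segmentSum (fun m => chowSum m 1) X n s =
        chowSum (n + 1) t + ∑ s ∈ Finset.Icc t (n + 1), (s : ℤ[X]) *
          (chowSum n 1 - chowSum n s) := by
      rw [chowSum_succ n t ht, ← Finset.sum_add_distrib]
      refine Finset.sum_congr rfl fun s hs => ?_
      rw [ih s (ht.trans (Finset.mem_Icc.1 hs).1)]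
      ring
    rw [this]
    ring

lemma segmentSum_one (n t : ℕ) (ht : 1 ≤ t) :
    segmentSum (fun m => if m = 0 then 1 else X * chowSum m 1) 1 n t =
      augChowSum n t + X * (chowSum n 1 - chowSum n t) := by
  induction n generalizing t with
  | zero => simp [segmentSum_zero, chowSum_zero, augChowSum_zero]
  | succ n ih =>
    rw [segmentSum_succ, augChowSum_succ n t ht, if_neg n.succ_ne_zero, one_mul]
    have : ∑ s ∈ Finset.Icc t (n + 1), (s : ℤ[X]) *
        segmentSum (fun m => if m = 0 then 1 else X * chowSum m 1) 1 n s =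
        chowSum (n + 1) t + X * ∑ s ∈ Finset.Icc t (n + 1), (s : ℤ[X]) *
          (chowSum n 1 - chowSum n s) := by
      rw [chowSum_succ n t ht, Finset.mul_sum, ← Finset.sum_add_distrib]
      refine Finset.sum_congr rfl fun s hs => ?_
      rw [ih s (ht.trans (Finset.mem_Icc.1 hs).1)]
      ring
    rw [this]
    ring

lemma segmentSum_at_one (w : ℕ → ℤ[X]) (z : ℤ[X]) (n : ℕ) :
    segmentSum w z n 1 = ∑ j ∈ Finset.range (n + 1),
      (Nat.stirlingSecond (n + 1) (n + 1 - j) : ℤ[X]) * z ^ j * w (n - j) := by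
  refine Finset.sum_congr rfl fun j hj => ?_
  rw [hsum_one_eq_stirlingSecond, Nat.sub_add_cancel (by have := Finset.mem_range.1 hj; omega)]

end Sequences

/-! ### The lattice of equivalence relations on a finite type -/

section Setoid

instance {α : Type*} [Finite α] : Finite (Setoid α) :=
  Finite.of_injective (fun r : Setoid α => (r : α → α → Prop)) fun _ _ h =>
    Setoid.ext fun a b => iff_of_eq (congrFun (congrFun h a) b)

instance {α : Type*} [Finite α] : Fintype (Setoid α) := Fintype.ofFinite _

/-- The number of classes of an equivalence relation. -/
def numClasses {α : Type*} (r : Setoid α) : ℕ := Nat.card (Quotient r)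

/-- Functions with a given kernel are the injections from the quotient. -/
def kerEquivEmbedding {α β : Type*} (r : Setoid α) :
    {f : α → β // Setoid.ker f = r} ≃ (Quotient r ↪ β) where
  toFun f := ⟨Quotient.lift f.1 fun a b h => (f.2.symm ▸ h : Setoid.ker f.1 a b), by
    obtain ⟨f, rfl⟩ := f
    exact Setoid.kerLift_injective f⟩
  invFun g := ⟨fun a => g (Quotient.mk r a), Setoid.ext fun a b => by
    rw [Setoid.ker_def, g.injective.eq_iff, Quotient.eq]⟩
  left_inv f := rfl
  right_inv g := by
    ext q
    induction q using Quotient.inductionOn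
    rfl

lemma numClasses_le {α : Type*} [Finite α] (r : Setoid α) : numClasses r ≤ Nat.card α :=
  Nat.card_le_card_of_surjective (Quotient.mk r) Quotient.mk_surjective

lemma sum_descFactorial_numClasses {α : Type*} [Finite α] (x : ℕ) :
    ∑ r : Setoid α, x.descFactorial (numClasses r) = x ^ Nat.card α := by
  classical
  have := Fintype.ofFinite α
  have h : ∀ r : Setoid α, x.descFactorial (numClasses r) =
      Fintype.card {f : α → Fin x // Setoid.ker f = r} := by
    intro r
    have := Fintype.ofFinite (Quotient r)
    rw [Fintype.card_congr (kerEquivEmbedding r), Fintype.card_embedding_eq, Fintype.card_fin,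
      numClasses, Nat.card_eq_fintype_card]
  rw [Finset.sum_congr rfl fun r _ => h r, ← Fintype.card_sigma,
    Fintype.card_congr (Equiv.sigmaFiberEquiv _)]
  simp

lemma sum_stirlingSecond_mul_descFactorial (n x : ℕ) :
    ∑ k ∈ Finset.range (n + 1), n.stirlingSecond k * x.descFactorial k = x ^ n := by
  induction n with
  | zero => simp
  | succ n ih =>
    have h : ∀ k, x.descFactorial (k + 1) + k * x.descFactorial k = x * x.descFactorial k := by
      intro k
      rw [Nat.descFactorial_succ, ← add_mul]
      rcases le_or_gt k x with hk | hk
      · rw [Nat.sub_add_cancel hk]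
      · simp [Nat.descFactorial_of_lt hk]
    rw [pow_succ', ← ih, Finset.mul_sum, Finset.sum_range_succ', Nat.stirlingSecond_succ_zero,
      zero_mul, add_zero]
    have h1 : ∀ k, x * (n.stirlingSecond k * x.descFactorial k) =
        n.stirlingSecond k * x.descFactorial (k + 1) +
          k * n.stirlingSecond k * x.descFactorial k := by
      intro k
      rw [mul_left_comm, ← h]
      ring
    have h2 : ∑ k ∈ Finset.range (n + 1),
        (k + 1) * n.stirlingSecond (k + 1) * x.descFactorial (k + 1) =
        ∑ k ∈ Finset.range (n + 1), k * n.stirlingSecond k * x.descFactorial k := by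
      rw [Finset.sum_range_succ, Nat.stirlingSecond_eq_zero_of_lt (Nat.lt_succ_self n),
        Finset.sum_range_succ' (fun k => k * n.stirlingSecond k * x.descFactorial k)]
      simp
    rw [Finset.sum_congr rfl fun k _ => h1 k, Finset.sum_add_distrib, ← h2,
      ← Finset.sum_add_distrib]
    refine Finset.sum_congr rfl fun k _ => ?_
    rw [Nat.stirlingSecond_succ_succ]
    ring

/-- The falling factorials are linearly independent. -/
lemma eq_of_sum_mul_descFactorial_eq {n : ℕ} {u v : ℕ → ℕ}
    (h : ∀ x : ℕ, ∑ k ∈ Finset.range (n + 1), u k * x.descFactorial k =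
      ∑ k ∈ Finset.range (n + 1), v k * x.descFactorial k) {k : ℕ} (hk : k ≤ n) : u k = v k := by
  induction k using Nat.strong_induction_on with
  | _ k ih =>
  have key : ∀ w : ℕ → ℕ, ∑ i ∈ Finset.range (n + 1), w i * k.descFactorial i =
      (∑ i ∈ Finset.range k, w i * k.descFactorial i) + w k * k.factorial := by
    intro w
    rw [← Nat.descFactorial_self k, ← Finset.sum_range_succ]
    symm
    refine Finset.sum_subset (Finset.range_subset_range.2 (by omega)) fun i _ hi => ?_
    rw [Finset.mem_range, not_lt] at hi
    rw [Nat.descFactorial_of_lt (by omega), mul_zero]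
  have e := h k
  rw [key, key, Finset.sum_congr rfl fun i hi => by
    rw [ih i (Finset.mem_range.1 hi) (by have := Finset.mem_range.1 hi; omega)]] at e
  exact Nat.eq_of_mul_eq_mul_right k.factorial_pos (Nat.add_left_cancel e)

/-- Stirling numbers of the second kind count equivalence relations by their number of classes. -/
lemma card_filter_numClasses_eq {α : Type*} [Finite α] (k : ℕ) :
    (Finset.univ.filter fun r : Setoid α => numClasses r = k).card =
      (Nat.card α).stirlingSecond k := by
  rcases le_or_gt k (Nat.card α) with hk | hk
  · refine eq_of_sum_mul_descFactorial_eq (n := Nat.card α)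
      (u := fun k => (Finset.univ.filter fun r : Setoid α => numClasses r = k).card)
      (fun x => ?_) hk
    rw [sum_stirlingSecond_mul_descFactorial, ← sum_descFactorial_numClasses x,
      ← Finset.sum_fiberwise_of_maps_to (t := Finset.range (Nat.card α + 1)) (g := numClasses)
        fun r _ => Finset.mem_range.2 (Nat.lt_succ_of_le (numClasses_le r))]
    refine Finset.sum_congr rfl fun k _ => ?_
    rw [Finset.sum_congr rfl fun r hr => by rw [(Finset.mem_filter.1 hr).2], Finset.sum_const,
      smul_eq_mul]
  · rw [Nat.stirlingSecond_eq_zero_of_lt hk, Finset.card_eq_zero, Finset.filter_eq_empty_iff]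
    intro r _ h
    have := numClasses_le r
    omega

lemma numClasses_comap_mk {α : Type*} (r : Setoid α) (t : Setoid (Quotient r)) :
    numClasses (Setoid.comap (Quotient.mk r) t) = numClasses t := by
  refine Nat.card_eq_of_bijective
    (Quotient.lift (fun a => Quotient.mk t (Quotient.mk r a)) fun a b h => Quotient.sound h)
    ⟨fun p q => ?_, fun q => ?_⟩
  · induction p, q using Quotient.inductionOn₂ with
    | _ a b =>
    exact fun h => Quotient.sound ((Quotient.eq (r := t)).1 h)
  · obtain ⟨q, rfl⟩ := Quotient.mk_surjective q
    obtain ⟨a, rfl⟩ := Quotient.mk_surjective q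
    exact ⟨Quotient.mk _ a, rfl⟩

open scoped Classical in
lemma card_filter_le_numClasses_eq {α : Type*} [Finite α] (r : Setoid α) (k : ℕ) :
    (Finset.univ.filter fun s : Setoid α => r ≤ s ∧ numClasses s = k).card =
      (numClasses r).stirlingSecond k := by
  rw [numClasses, ← card_filter_numClasses_eq k]
  symm
  have hinv : ∀ t, (((Setoid.correspondence r).symm t : {s // r ≤ s}) : Setoid α) =
      Setoid.comap (Quotient.mk r) t := fun t => rfl
  refine Finset.card_bij (fun t _ => ((Setoid.correspondence r).symm t : {s // r ≤ s}).1) ?_ ?_ ?_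
  · intro t ht
    rw [Finset.mem_filter] at ht ⊢
    refine ⟨Finset.mem_univ _, ((Setoid.correspondence r).symm t).2, ?_⟩
    rw [hinv, numClasses_comap_mk, ht.2]
  · intro t _ t' _ h
    exact (Setoid.correspondence r).symm.injective (Subtype.ext h)
  · intro s hs
    rw [Finset.mem_filter] at hs
    refine ⟨Setoid.correspondence r ⟨s, hs.2.1⟩, ?_, by simp⟩
    rw [Finset.mem_filter]
    refine ⟨Finset.mem_univ _, ?_⟩
    rw [← numClasses_comap_mk, ← hinv]
    simpa using hs.2.2

lemma numClasses_lt_of_lt {α : Type*} [Finite α] {r s : Setoid α} (h : r < s) :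
    numClasses s < numClasses r := by
  let g : Quotient r → Quotient s := Quotient.map id fun _ _ hab => h.le hab
  have hg : Function.Surjective g := by
    intro q
    obtain ⟨a, rfl⟩ := Quotient.mk_surjective q
    exact ⟨Quotient.mk _ a, rfl⟩
  have := Fintype.ofFinite (Quotient r)
  have := Fintype.ofFinite (Quotient s)
  rw [numClasses, numClasses, Nat.card_eq_fintype_card, Nat.card_eq_fintype_card]
  refine Fintype.card_lt_of_surjective_not_injective g hg fun hi => h.not_ge fun a b hab => ?_
  exact Quotient.exact (hi (show g (Quotient.mk r a) = g (Quotient.mk r b) from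
    Quotient.sound hab))

/-- Splitting one element off its class. -/
def splitOff {α : Type*} (r : Setoid α) (i : α) : Setoid α where
  r a b := a = b ∨ (r a b ∧ a ≠ i ∧ b ≠ i)
  iseqv := by
    refine ⟨fun a => Or.inl rfl, ?_, ?_⟩
    · rintro a b (rfl | ⟨h, ha, hb⟩)
      · exact Or.inl rfl
      · exact Or.inr ⟨r.symm' h, hb, ha⟩
    · rintro a b c (rfl | ⟨h, ha, hb⟩) (rfl | ⟨h', hb', hc⟩)
      · exact Or.inl rfl
      · exact Or.inr ⟨h', hb', hc⟩
      · exact Or.inr ⟨h, ha, hb⟩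
      · exact Or.inr ⟨r.trans' h h', ha, hc⟩

lemma splitOff_lt {α : Type*} {r : Setoid α} {i j : α} (hij : i ≠ j) (h : r i j) :
    splitOff r i < r := by
  refine lt_of_le_not_ge ?_ fun h' => ?_
  · rintro a b (rfl | ⟨h, -⟩)
    · exact r.refl' _
    · exact h
  · obtain h' | h' := h' h
    · exact hij h'
    · exact h'.2.1 rfl

lemma numClasses_splitOff_le {α : Type*} [Finite α] (r : Setoid α) (i : α) :
    numClasses (splitOff r i) ≤ numClasses r + 1 := by
  classical
  rw [numClasses, numClasses, ← Finite.card_option]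
  refine Nat.card_le_card_of_injective (Quotient.lift
    (fun a => if a = i then none else some (Quotient.mk r a)) ?_) ?_
  · rintro a b (rfl | ⟨h, ha, hb⟩)
    · rfl
    · simp only [ha, hb, if_false]
      rw [Quotient.sound h]
  · intro p q
    induction p, q using Quotient.inductionOn₂ with
    | _ a b =>
    intro h
    simp only [Quotient.lift_mk] at h
    split_ifs at h with ha hb hb
    · rw [ha, hb]
    · exact Quotient.sound (Or.inr ⟨Quotient.exact (Option.some.inj h), ha, hb⟩)

lemma height_setoid {α : Type*} [Finite α] (r : Setoid α) :
    Order.height r = (Nat.card α - numClasses r : ℕ) := by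
  induction r using WellFoundedLT.induction with
  | ind r ih =>
  refine le_antisymm (Order.height_le_coe_iff.2 fun s hs => ?_) ?_
  · rw [ih s hs, Nat.cast_lt]
    have := numClasses_lt_of_lt hs
    have := numClasses_le s
    omega
  · rcases (numClasses_le r).eq_or_lt with h | h
    · simp [h]
    · obtain ⟨i, j, hij, hne⟩ : ∃ i j, r i j ∧ i ≠ j := by
        by_contra! hc
        refine h.ne' (Nat.card_eq_of_bijective (Quotient.mk r)
          ⟨fun a b hab => hc a b (Quotient.exact hab), Quotient.mk_surjective⟩)
      have hlt := splitOff_lt hne hij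
      refine le_trans ?_ (Order.height_add_one_le hlt)
      rw [ih _ hlt]
      have := numClasses_splitOff_le r i
      exact_mod_cast (by omega : _ ≤ _)

lemma numClasses_pos {α : Type*} [Finite α] [Nonempty α] (r : Setoid α) : 0 < numClasses r :=
  have : Nonempty (Quotient r) := (nonempty_quotient_iff r).2 inferInstance
  Nat.card_pos

lemma numClasses_eq_one_iff {α : Type*} [Finite α] [Nonempty α] {r : Setoid α} :
    numClasses r = 1 ↔ r = ⊤ := by
  refine ⟨fun h => ?_, ?_⟩
  · by_contra hr
    have := numClasses_lt_of_lt (Ne.lt_top hr)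
    have := numClasses_pos (⊤ : Setoid α)
    omega
  · rintro rfl
    have : Nonempty (Quotient (⊤ : Setoid α)) := (nonempty_quotient_iff _).2 inferInstance
    have : Subsingleton (Quotient (⊤ : Setoid α)) := Quotient.subsingleton_iff.2 rfl
    exact Nat.card_of_subsingleton (Classical.arbitrary _)

open scoped Classical in
/-- Sums over the equivalence relations coarser than a given one. -/
lemma sum_setoid_eq_segmentSum {α : Type*} [Finite α] [Nonempty α] (r : Setoid α) (z : ℤ[X])
    (w : ℕ → ℤ[X]) :
    ∑ s : Setoid α with r ≤ s, z ^ (numClasses r - numClasses s) * w (numClasses s - 1) =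
      segmentSum w z (numClasses r - 1) 1 := by
  obtain ⟨p, hp⟩ := Nat.exists_eq_succ_of_ne_zero (numClasses_pos r).ne'
  have hle : ∀ s : Setoid α, r ≤ s → numClasses s ≤ p + 1 := by
    intro s hs
    rcases hs.eq_or_lt with rfl | hs
    · exact hp.le
    · have := numClasses_lt_of_lt hs
      omega
  rw [segmentSum_at_one, hp, Nat.succ_sub_one, ← Finset.sum_fiberwise_of_maps_to
    (t := Finset.range (p + 1)) (g := fun s => p + 1 - numClasses s)]
  · refine Finset.sum_congr rfl fun j hj => ?_
    rw [Finset.mem_range] at hj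
    have h1 : (Finset.univ.filter fun s : Setoid α => r ≤ s).filter
        (fun s => p + 1 - numClasses s = j) =
        Finset.univ.filter fun s : Setoid α => r ≤ s ∧ numClasses s = p + 1 - j := by
      rw [Finset.filter_filter]
      refine Finset.filter_congr fun s _ => and_congr_right fun hs => ?_
      have := hle s hs
      omega
    rw [h1, Finset.sum_congr rfl (g := fun _ => z ^ j * w (p - j)), Finset.sum_const,
      card_filter_le_numClasses_eq, hp, nsmul_eq_mul, mul_assoc]
    intro s hs
    rw [(Finset.mem_filter.1 hs).2.2, Nat.succ_eq_add_one, Nat.sub_sub_self (by omega),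
      show p + 1 - j - 1 = p - j by omega]
  · intro s _
    have := numClasses_pos s
    rw [Finset.mem_range]
    omega

end Setoid

/-! ### Flats of the braid arrangement -/

section Braid

/-- The coordinates that agree on a flat. -/
def flatSetoid {n : ℕ} (F : Flat (braidArrangement n)) : Setoid (Fin (n + 1)) where
  r i j := ∀ x ∈ F.space, x.1 i = x.1 j
  iseqv := ⟨fun _ _ _ => rfl, fun h x hx => (h x hx).symm,
    fun h h' x hx => (h x hx).trans (h' x hx)⟩

lemma flatSetoid_le_iff {n : ℕ} {F G : Flat (braidArrangement n)} :
    flatSetoid F ≤ flatSetoid G ↔ F ≤ G := by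
  refine ⟨fun h => ?_, fun h i j hij x hx => hij x (h hx)⟩
  obtain ⟨S, hS, hF⟩ := F.exists_sInf_eq
  intro x hx
  rw [← hF, Submodule.mem_sInf]
  intro H hH
  obtain ⟨i, j, -, rfl⟩ := hS hH
  refine h (x := i) (y := j) (fun y hy => ?_) x hx
  rw [← hF, Submodule.mem_sInf] at hy
  exact hy _ hH

lemma flatSetoid_surjective (n : ℕ) :
    Function.Surjective (flatSetoid : Flat (braidArrangement n) → Setoid (Fin (n + 1))) := by
  classical
  intro r
  let S : Set (Submodule ℝ (sumZero n)) := {H | ∃ i j, i < j ∧ r i j ∧ H = hyperplane i j}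
  have hS : S ⊆ braidArrangement n := by
    rintro H ⟨i, j, hij, -, rfl⟩
    exact ⟨i, j, hij, rfl⟩
  refine ⟨⟨sInf S, S, hS, rfl⟩, Setoid.ext fun i j => ⟨fun h => ?_, fun h x hx => ?_⟩⟩
  · let c : ℝ := (∑ k, if r i k then 1 else 0) / (n + 1)
    let x : sumZero n := ⟨fun k => (if r i k then 1 else 0) - c, by
      change ∑ k, ((if r i k then 1 else 0) - c) = 0
      rw [Finset.sum_sub_distrib, Finset.sum_const, Finset.card_univ, Fintype.card_fin,
        nsmul_eq_mul]
      push_cast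
      rw [mul_div_cancel₀ _ (by positivity), sub_self]⟩
    have hx : x ∈ sInf S := by
      rw [Submodule.mem_sInf]
      rintro H ⟨a, b, -, hab, rfl⟩
      change (if r i a then (1 : ℝ) else 0) - c = (if r i b then 1 else 0) - c
      have : r i a ↔ r i b := ⟨fun h => r.trans' h hab, fun h => r.trans' h (r.symm' hab)⟩
      simp only [this]
    have h1 : (if r i i then (1 : ℝ) else 0) - c = (if r i j then 1 else 0) - c := h x hx
    by_contra hij
    rw [if_pos (r.refl' i), if_neg hij] at h1
    linarith
  · rw [Submodule.mem_sInf] at hx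
    rcases lt_trichotomy i j with hij | rfl | hij
    · exact hx _ ⟨i, j, hij, h, rfl⟩
    · rfl
    · exact (hx _ ⟨j, i, hij, r.symm' h, rfl⟩ : x.1 j = x.1 i).symm

/-- The lattice of flats of the braid arrangement is the lattice of equivalence relations. -/
def flatOrderIso (n : ℕ) : Flat (braidArrangement n) ≃o Setoid (Fin (n + 1)) :=
  RelIso.ofSurjective (OrderEmbedding.ofMapLEIff flatSetoid fun _ _ => flatSetoid_le_iff)
    (flatSetoid_surjective n)

lemma rank_flat {n : ℕ} (F : Flat (braidArrangement n)) :
    rank F = n + 1 - numClasses (flatOrderIso n F) := by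
  rw [rank, ← Order.height_orderIso (flatOrderIso n), height_setoid, ENat.toNat_natCast,
    Nat.card_fin]

open scoped Classical in
lemma sum_flat_eq_segmentSum {n : ℕ} (F : Flat (braidArrangement n)) (z : ℤ[X])
    (w : ℕ → ℤ[X]) :
    ∑ G : Flat (braidArrangement n) with F ≤ G,
      z ^ (rank G - rank F) * w (numClasses (flatOrderIso n G) - 1) =
      segmentSum w z (numClasses (flatOrderIso n F) - 1) 1 := by
  rw [← sum_setoid_eq_segmentSum, Finset.sum_filter, Finset.sum_filter]
  refine Fintype.sum_equiv (flatOrderIso n).toEquiv _ _ fun G => ?_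
  have h1 := numClasses_le (flatOrderIso n F)
  have h2 := numClasses_le (flatOrderIso n G)
  rw [Nat.card_fin] at h1 h2
  rw [rank_flat, rank_flat, RelIso.coe_fn_toEquiv, (flatOrderIso n).le_iff_le,
    show ∀ a b, a ≤ n + 1 → b ≤ n + 1 → n + 1 - b - (n + 1 - a) = a - b by omega]
  · exact h1
  · exact h2

lemma upperChow_flat {n : ℕ} (F : Flat (braidArrangement n)) :
    upperChow F = chowSum (numClasses (flatOrderIso n F) - 1) 1 := by
  classical
  refine upperChow_eq_of_recursion (fun F => chowSum (numClasses (flatOrderIso n F) - 1) 1)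
    (fun F => ?_) F
  have h1 := sum_flat_eq_segmentSum F X (fun m => chowSum m 1)
  have h2 := sum_flat_eq_segmentSum F 1 (fun m => if m = 0 then 1 else X * chowSum m 1)
  rw [segmentSum_X _ _ le_rfl] at h1
  rw [segmentSum_one _ _ le_rfl] at h2
  have h3 : ∀ G : Flat (braidArrangement n),
      numClasses (flatOrderIso n G) - 1 = 0 ↔ G = ⊤ := by
    intro G
    have := numClasses_pos (flatOrderIso n G)
    rw [← (flatOrderIso n).injective.eq_iff, map_top, ← numClasses_eq_one_iff]
    omega
  simp only [h3, one_pow, one_mul] at h2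
  rw [h1, h2]
  ring

lemma numClasses_flat_bot (n : ℕ) :
    numClasses (flatOrderIso n (⊥ : Flat (braidArrangement n))) = n + 1 := by
  have h := rank_flat (⊥ : Flat (braidArrangement n))
  have h1 := numClasses_le (flatOrderIso n (⊥ : Flat (braidArrangement n)))
  rw [rank, Order.height_bot, ENat.toNat_zero] at h
  rw [Nat.card_fin] at h1
  omega

lemma chowPolynomial_flat (n : ℕ) :
    chowPolynomial (Flat (braidArrangement n)) = chowSum n 1 := by
  rw [chowPolynomial_eq_upperChow, upperChow_flat, numClasses_flat_bot, Nat.add_sub_cancel]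

lemma augChowPolynomial_flat (n : ℕ) :
    augChowPolynomial (Flat (braidArrangement n)) = augChowSum n 1 := by
  classical
  have h := sum_flat_eq_segmentSum (⊥ : Flat (braidArrangement n)) X (fun m => chowSum m 1)
  rw [segmentSum_X _ _ le_rfl, numClasses_flat_bot, Nat.add_sub_cancel, add_sub_cancel_right] at h
  rw [augChowPolynomial_eq_sum, ← h, Finset.filter_true_of_mem fun _ _ => bot_le]
  refine Finset.sum_congr rfl fun F _ => ?_
  rw [upperChow_flat, rank, rank, Order.height_bot, ENat.toNat_zero, Nat.sub_zero]

end Braid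

end ChowPoly

end

theorem mainTheorem5 (n : ℕ) :
    (1 ≤ n →
      ChowPoly.chowPolynomial (ChowPoly.Flat (ChowPoly.braidArrangement n)) =
        ∑ a ∈ ChowPoly.sequences n with
            ChowPoly.IsIsolated (ChowPoly.Des a) ∧ 1 ∉ ChowPoly.Des a,
          (∏ i, (a i : ℤ[X])) * X ^ (ChowPoly.Des a).card *
            (X + 1) ^ (n - 1 - 2 * (ChowPoly.Des a).card)) ∧
    ChowPoly.augChowPolynomial (ChowPoly.Flat (ChowPoly.braidArrangement n)) =
      ∑ a ∈ ChowPoly.sequences n with ChowPoly.IsIsolated (ChowPoly.Des a),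
        (∏ i, (a i : ℤ[X])) * X ^ (ChowPoly.Des a).card *
          (X + 1) ^ (n - 2 * (ChowPoly.Des a).card) := by
  rw [ChowPoly.chowPolynomial_flat, ChowPoly.augChowPolynomial_flat, ChowPoly.chowSum_one,
    ChowPoly.augChowSum_one]
  exact ⟨fun _ => rfl, rfl⟩
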